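/- \textbf{Setting.} Let $M$ be a unital complex $C^*$-algebra with norm $\|\cdot\|$. Let $\mathcal I_0\subset M$ be a two-sided ideal (not necessarily closed in $M$) equipped with a norm $\|\cdot\|_{\mathcal I}$ such that $$\|XYZ\|_{\mathcal I}\le \|X\|\,\|Y\|_{\mathcal I}\,\|Z\|\qquad\text{for all } X,Z\in M,\ Y\in\mathcal I_0 ,$$ and let $\mathcal I$ be the completion of $\mathcal I_0$ with respect to $\|\cdot\|_{\mathcal I}$ (a \emph{normed ideal in $M$ with a unitarily invariant norm}). For $A\in M$, the maps $Y\mapsto AY$ and $Y\mapsto YA$ on $\mathcal I_0$ are bounded for $\|\cdot\|_{\mathcal I}$; their continuous extensions to $\mathcal I$ are again written $X\mapsto AX$ and $X\mapsto XA$. \textbf{Proposition} (arithmetic--geometric mean inequality). For all $A,B\in M$ and all $X\in\mathcal I$, $$\|AA^*X+XBB^*\|_{\mathcal I}\ \ge\ 2\,\|A^*XB\|_{\mathcal I}.$$ -/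

import Mathlib

/-- The pre-completion data of a normed ideal with a unitarily invariant norm in a (unital)
C⋆-algebra `M`: a two-sided ideal `I₀` of `M` (not assumed closed in `M`), together with a norm
`‖·‖_I` on `I₀` such that `‖X Y Z‖_I ≤ ‖X‖ ‖Y‖_I ‖Z‖` for `X, Z ∈ M` and `Y ∈ I₀`. -/
structure NormedIdeal (M : Type*) [CStarAlgebra M] extends Submodule ℂ M where
  mul_mem_left' : ∀ (X : M) {Y : M}, Y ∈ toSubmodule → X * Y ∈ toSubmodule
  mul_mem_right' : ∀ {Y : M} (Z : M), Y ∈ toSubmodule → Y * Z ∈ toSubmodule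
  /-- the norm `‖·‖_I` on the ideal `I₀` -/
  idealNorm : toSubmodule → ℝ
  idealNorm_add_le : ∀ Y Y' : toSubmodule, idealNorm (Y + Y') ≤ idealNorm Y + idealNorm Y'
  idealNorm_smul : ∀ (c : ℂ) (Y : toSubmodule), idealNorm (c • Y) = ‖c‖ * idealNorm Y
  eq_zero_of_idealNorm : ∀ Y : toSubmodule, idealNorm Y = 0 → Y = 0
  idealNorm_mul_mul_le : ∀ (X Z : M) (Y : toSubmodule),
    idealNorm ⟨X * Y * Z, mul_mem_right' Z (mul_mem_left' X Y.2)⟩ ≤ ‖X‖ * idealNorm Y * ‖Z‖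

namespace NormedIdeal

variable {M : Type*} [CStarAlgebra M] (I : NormedIdeal M)

/-- The vector space `I₀`, as a type synonym which carries the norm `‖·‖_I`
(and not the norm inherited from `M`). -/
def Core : Type _ := I.toSubmodule

noncomputable instance : AddCommGroup I.Core := inferInstanceAs (AddCommGroup I.toSubmodule)

noncomputable instance : Module ℂ I.Core := inferInstanceAs (Module ℂ I.toSubmodule)

/-- The element of `M` underlying an element of `I₀`. -/
def Core.val {I : NormedIdeal M} (Y : I.Core) : M := Subtype.val (p := (· ∈ I.toSubmodule)) Y

noncomputable instance : Norm I.Core := ⟨I.idealNorm⟩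

theorem idealNorm_zero : I.idealNorm 0 = 0 := by
  simpa using I.idealNorm_smul 0 0

theorem idealNorm_nonneg (Y : I.toSubmodule) : 0 ≤ I.idealNorm Y := by
  have h1 : I.idealNorm ((-1 : ℂ) • Y) = I.idealNorm Y := by
    rw [I.idealNorm_smul, norm_neg, norm_one, one_mul]
  have h2 := I.idealNorm_add_le Y ((-1 : ℂ) • Y)
  have h3 : Y + (-1 : ℂ) • Y = 0 := by
    rw [neg_one_smul, add_neg_cancel]
  rw [h3, I.idealNorm_zero, h1] at h2
  linarith

theorem normedSpaceCore : NormedSpace.Core ℂ I.Core where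
  norm_nonneg Y := I.idealNorm_nonneg Y
  norm_smul c Y := I.idealNorm_smul c Y
  norm_triangle Y Y' := I.idealNorm_add_le Y Y'
  norm_eq_zero_iff Y := ⟨I.eq_zero_of_idealNorm Y, fun h => by
    rw [h]; exact I.idealNorm_zero⟩

noncomputable instance : NormedAddCommGroup I.Core := NormedAddCommGroup.ofCore I.normedSpaceCore

noncomputable instance : NormedSpace ℂ I.Core := NormedSpace.ofCore I.normedSpaceCore

/-- The Banach space `I`: the completion of `I₀` with respect to `‖·‖_I`. -/
abbrev Completion : Type _ := UniformSpace.Completion I.Core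

/-- `Y ↦ A Y` on `I₀`, a bounded operator for the norm `‖·‖_I`. -/
noncomputable def coreLeftMul (A : M) : I.Core →L[ℂ] I.Core :=
  LinearMap.mkContinuous
    { toFun := fun Y => (⟨A * Y.val, I.mul_mem_left' A Y.2⟩ : I.toSubmodule)
      map_add' := fun Y Y' => Subtype.ext (mul_add A Y.val Y'.val)
      map_smul' := fun c Y => Subtype.ext (mul_smul_comm c A Y.val) }
    ‖A‖ (fun Y => by
      have h := I.idealNorm_mul_mul_le A 1 Y
      have h1 : ‖(1 : M)‖ ≤ 1 := by
        cases subsingleton_or_nontrivial M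
        · simp [Subsingleton.elim (1 : M) 0]
        · simp
      simp only [mul_one] at h
      exact h.trans (mul_le_of_le_one_right
        (mul_nonneg (norm_nonneg A) (I.normedSpaceCore.norm_nonneg Y)) h1))

/-- `Y ↦ Y B` on `I₀`, a bounded operator for the norm `‖·‖_I`. -/
noncomputable def coreRightMul (B : M) : I.Core →L[ℂ] I.Core :=
  LinearMap.mkContinuous
    { toFun := fun Y => (⟨Y.val * B, I.mul_mem_right' B Y.2⟩ : I.toSubmodule)
      map_add' := fun Y Y' => Subtype.ext (add_mul Y.val Y'.val B)
      map_smul' := fun c Y => Subtype.ext (smul_mul_assoc c Y.val B) }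
    ‖B‖ (fun Y => by
      have h := I.idealNorm_mul_mul_le 1 B Y
      have h1 : ‖(1 : M)‖ ≤ 1 := by
        cases subsingleton_or_nontrivial M
        · simp [Subsingleton.elim (1 : M) 0]
        · simp
      simp only [one_mul] at h
      refine h.trans ?_
      rw [mul_comm ‖B‖]
      exact mul_le_mul_of_nonneg_right
        (mul_le_of_le_one_left (I.normedSpaceCore.norm_nonneg Y) h1) (norm_nonneg B))

/-- Left multiplication `X ↦ A X` by `A ∈ M` on the completion `I`: the continuous extension of
left multiplication on `I₀`. -/
noncomputable def leftMul (A : M) : I.Completion →L[ℂ] I.Completion :=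
  (I.coreLeftMul A).completion

/-- Right multiplication `X ↦ X B` by `B ∈ M` on the completion `I`: the continuous extension of
right multiplication on `I₀`. -/
noncomputable def rightMul (B : M) : I.Completion →L[ℂ] I.Completion :=
  (I.coreRightMul B).completion

theorem coreLeftMul_val (A : M) (Y : I.Core) : (I.coreLeftMul A Y).val = A * Y.val := rfl

theorem coreRightMul_val (B : M) (Y : I.Core) : (I.coreRightMul B Y).val = Y.val * B := rfl

theorem leftMul_coe (A : M) (Y : I.Core) :
    I.leftMul A (Y : I.Completion) = (I.coreLeftMul A Y : I.Completion) :=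
  UniformSpace.Completion.map_coe (I.coreLeftMul A).uniformContinuous Y

theorem rightMul_coe (B : M) (Y : I.Core) :
    I.rightMul B (Y : I.Completion) = (I.coreRightMul B Y : I.Completion) :=
  UniformSpace.Completion.map_coe (I.coreRightMul B).uniformContinuous Y

end NormedIdeal

/-! Suppose first that `A` and `B` are exponentials of self-adjoint `H`, `K`, and let `D` be the
operator `Y ↦ HY - YK` on the completion. With `Y = e^H X e^K` one has `e^{2H} X + X e^{2K} = e^D Y
+ e^{-D} Y`, so the claim becomes `‖2 cosh(D) Y‖ ≥ 2‖Y‖`.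

The operator `D` is Hermitian to first order, `‖1 + iεD‖ ≤ 1 + O(ε²)`, which gives `‖(D - r) Y‖ ≥
|r| ‖Y‖` for imaginary `r`. Since `2 cosh` is a limit of polynomials with imaginary zeros and value
`2` at `0`, multiplying the bounds for the linear factors gives the claim
(`two_mul_norm_le_norm_exp_add_exp_neg`).

In general, `A* = V e^H` with `V` a contraction and `e^{2H} = AA* + ε`, and likewise for `B`
(`CStarAlgebra.exists_eq_mul_exp`). Contractions do not increase the ideal norm, and `ε → 0`
finishes the proof. -/

/-! ### The exponential as a limit of powers in a Banach algebra. -/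

open Filter Topology in
theorem tendsto_one_add_smul_pow_exp {𝔸 : Type*} [NormedRing 𝔸] [NormOneClass 𝔸]
    [NormedAlgebra ℂ 𝔸] [CompleteSpace 𝔸] (x : 𝔸) :
    Tendsto (fun n : ℕ => (1 + (n : ℂ)⁻¹ • x) ^ n) atTop (𝓝 (NormedSpace.exp x)) := by
  let _ : NormedAlgebra ℚ 𝔸 := NormedAlgebra.restrictScalars ℚ ℂ 𝔸
  have exp_le : ∀ y : 𝔸, ‖NormedSpace.exp y‖ ≤ Real.exp ‖y‖ := by
    intro y
    have h1 := (NormedSpace.exp_series_hasSum_exp' (𝕂 := ℝ) ‖y‖)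
    rw [← Real.exp_eq_exp_ℝ] at h1
    rw [← (NormedSpace.exp_series_hasSum_exp' (𝕂 := ℂ) y).tsum_eq]
    refine tsum_of_norm_bounded h1 fun n => ?_
    rw [norm_smul, norm_inv, Complex.norm_natCast, smul_eq_mul]
    gcongr
    exact norm_pow_le y n
  -- Factor `aⁿ - bⁿ` for the commuting elements `a = 1 + x/n` and `b = exp (x/n)`. Both have norm
  -- at most `exp (‖x‖/n)`, so each of the `n` terms of the cofactor is at most `exp ‖x‖`. The
  -- remaining factor `b - a` is `o(1/n)`.
  have key : ∀ n : ℕ, n ≠ 0 → ‖(1 + (n : ℂ)⁻¹ • x) ^ n - NormedSpace.exp x‖ ≤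
      (n : ℝ) * Real.exp ‖x‖ *
        ‖NormedSpace.exp ((n : ℂ)⁻¹ • x) - 1 - (n : ℂ)⁻¹ • x‖ := by
    intro n hn
    have hn' : (n : ℝ) ≠ 0 := by exact_mod_cast hn
    have hnc : (n : ℂ) ≠ 0 := by exact_mod_cast hn
    set y := (n : ℂ)⁻¹ • x with hy
    have hxy : x = n • y := by
      rw [hy, ← Nat.cast_smul_eq_nsmul ℂ, smul_smul, mul_inv_cancel₀ hnc, one_smul]
    have hnx : ‖x‖ = n * ‖y‖ := by
      rw [hy, norm_smul, norm_inv, Complex.norm_natCast]; field_simp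
    have hc : Commute (1 + y) (NormedSpace.exp y) :=
      ((Commute.one_left y).add_left (Commute.refl y)).exp_right
    have ha : ‖1 + y‖ ≤ Real.exp ‖y‖ := by
      refine (norm_add_le _ _).trans ?_
      rw [norm_one, add_comm]
      exact Real.add_one_le_exp _
    have hb := exp_le y
    conv_lhs => rw [hxy, NormedSpace.exp_nsmul, ← hc.mul_geom_sum₂]
    have hsum : ‖∑ i ∈ Finset.range n, (1 + y) ^ i * NormedSpace.exp y ^ (n - 1 - i)‖ ≤
        n * Real.exp ‖x‖ := by
      have : ∀ i ∈ Finset.range n,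
          ‖(1 + y) ^ i * NormedSpace.exp y ^ (n - 1 - i)‖ ≤ Real.exp ‖x‖ := by
        intro i hi
        have hi' := Finset.mem_range.1 hi
        calc _ ≤ ‖(1 + y) ^ i‖ * ‖NormedSpace.exp y ^ (n - 1 - i)‖ := norm_mul_le _ _
          _ ≤ ‖1 + y‖ ^ i * ‖NormedSpace.exp y‖ ^ (n - 1 - i) := by
            gcongr <;> exact norm_pow_le _ _
          _ ≤ Real.exp ‖y‖ ^ i * Real.exp ‖y‖ ^ (n - 1 - i) := by gcongr
          _ = Real.exp ‖y‖ ^ (n - 1) := by rw [← pow_add]; congr 1; omega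
          _ ≤ Real.exp ‖y‖ ^ n :=
            pow_le_pow_right₀ (Real.one_le_exp (norm_nonneg y)) (Nat.sub_le _ _)
          _ = Real.exp ‖x‖ := by rw [hnx, ← Real.exp_nat_mul]
      simpa using norm_sum_le_of_le _ this
    calc _ ≤ ‖1 + y - NormedSpace.exp y‖ *
          ‖∑ i ∈ Finset.range n, (1 + y) ^ i * NormedSpace.exp y ^ (n - 1 - i)‖ :=
          norm_mul_le _ _
      _ ≤ ‖1 + y - NormedSpace.exp y‖ * (n * Real.exp ‖x‖) := by gcongr
      _ = _ := by
        rw [mul_comm, ← norm_neg (1 + y - NormedSpace.exp y)]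
        congr 2
        abel
  rw [tendsto_iff_norm_sub_tendsto_zero]
  have hy0 : Tendsto (fun n : ℕ => (n : ℂ)⁻¹ • x) atTop (𝓝 0) := by
    simpa using (tendsto_inv_atTop_nhds_zero_nat (𝕜 := ℂ)).smul_const x
  have ho : (fun y : 𝔸 => NormedSpace.exp y - 1 - y) =o[𝓝 0] fun y => y := by
    have := (hasFDerivAt_exp_zero (𝕂 := ℂ) (𝔸 := 𝔸)).isLittleO
    simpa using this
  have ho' := (ho.comp_tendsto hy0).norm_norm
  have hlim : Tendsto (fun n : ℕ => (n : ℝ) *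
      ‖NormedSpace.exp ((n : ℂ)⁻¹ • x) - 1 - (n : ℂ)⁻¹ • x‖) atTop (𝓝 0) := by
    have h2 : (fun n : ℕ => ‖(n : ℂ)⁻¹ • x‖) =O[atTop] fun n : ℕ => ((n : ℝ))⁻¹ := by
      refine Asymptotics.IsBigO.of_bound ‖x‖ (Eventually.of_forall fun n => ?_)
      rw [norm_norm, norm_smul, norm_inv, norm_inv, Complex.norm_natCast, Real.norm_natCast,
        mul_comm]
    have h3 := (ho'.trans_isBigO h2).tendsto_div_nhds_zero
    refine h3.congr fun n => ?_
    simp [div_eq_mul_inv, mul_comm]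
  refine squeeze_zero' (Eventually.of_forall fun n => norm_nonneg _)
    ((eventually_ne_atTop 0).mono fun n hn => key n hn) ?_
  have := hlim.mul_const (Real.exp ‖x‖)
  rw [zero_mul] at this
  exact this.congr fun n => by ring

/-! ### Lower bounds for Hermitian-type operators on a Banach space. -/

section

open Polynomial

variable {E : Type*} [NormedAddCommGroup E] [NormedSpace ℂ E]

/-- With `r = iτ` and `z = Dy - ry`, one has `y + iεDy = (1 - ετ)y + iεz`. When `ετ ≤ 0`, the growth
`|ετ|‖y‖` must be absorbed by `|ε|‖z‖` up to `O(ε²)`; divide by `|ε|` and let `ε → 0`. -/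
theorem norm_smul_le_norm_sub_smul_of_quadratic_bound (D : E →L[ℂ] E) (C : ℝ)
    (hD : ∀ (ε : ℝ) (y : E), ‖y + (ε * Complex.I : ℂ) • D y‖ ≤ (1 + C * ε ^ 2) * ‖y‖)
    (r : ℂ) (hr : r.re = 0) (y : E) : ‖r‖ * ‖y‖ ≤ ‖D y - r • y‖ := by
  obtain ⟨τ, rfl⟩ : ∃ τ : ℝ, r = τ * Complex.I :=
    ⟨r.im, Complex.ext (by simp [hr]) (by simp)⟩
  set z := D y - (τ * Complex.I : ℂ) • y with hz
  have hDy : D y = z + (τ * Complex.I : ℂ) • y := by rw [hz]; abel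
  have h1 : ∀ ε : ℝ, |1 - ε * τ| * ‖y‖ ≤ (1 + C * ε ^ 2) * ‖y‖ + |ε| * ‖z‖ := by
    intro ε
    have e : ((1 - ε * τ : ℝ) : ℂ) • y =
        (y + (ε * Complex.I : ℂ) • D y) - (ε * Complex.I : ℂ) • z := by
      rw [hDy, smul_add, smul_smul,
        show (ε * Complex.I : ℂ) * (τ * Complex.I) = -(ε * τ) by
          linear_combination (ε * τ : ℂ) * Complex.I_mul_I]
      push_cast
      module
    have := norm_sub_le (y + (ε * Complex.I : ℂ) • D y) ((ε * Complex.I : ℂ) • z)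
    rw [← e, norm_smul, norm_smul, Complex.norm_real, Real.norm_eq_abs, norm_mul,
      Complex.norm_I, mul_one, Complex.norm_real, Real.norm_eq_abs] at this
    exact this.trans (by gcongr; exact hD ε y)
  have h2 : ∀ s : ℝ, 0 < s → |τ| * ‖y‖ ≤ ‖z‖ + s * (C * ‖y‖) := by
    intro s hs
    refine le_of_mul_le_mul_left ?_ hs
    -- The sign of `ε = ±s` is chosen so that `|1 - ετ| = 1 + s|τ|`.
    rcases le_total 0 τ with h | h
    · have := h1 (-s)
      rw [abs_neg, abs_of_pos hs, abs_of_nonneg (by nlinarith)] at this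
      rw [abs_of_nonneg h]
      linarith
    · have := h1 s
      rw [abs_of_pos hs, abs_of_nonneg (by nlinarith)] at this
      rw [abs_of_nonpos h]
      linarith
  have h3 : Filter.Tendsto (fun s : ℝ => ‖z‖ + s * (C * ‖y‖)) (nhdsWithin 0 (Set.Ioi 0))
      (nhds ‖z‖) := by
    have : Continuous fun s : ℝ => ‖z‖ + s * (C * ‖y‖) := by fun_prop
    simpa using (this.tendsto 0).mono_left nhdsWithin_le_nhds
  rw [norm_mul, Complex.norm_I, mul_one, Complex.norm_real, Real.norm_eq_abs]
  exact ge_of_tendsto h3 (Filter.eventually_of_mem self_mem_nhdsWithin h2)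

/-- Split `p` over `ℂ`: each factor `D - r` is bounded below by `‖r‖`, and the product of these
bounds with the leading coefficient is `‖p(0)‖`. -/
theorem norm_eval_zero_mul_le_norm_aeval (D : E →L[ℂ] E)
    (hD : ∀ r : ℂ, r.re = 0 → ∀ y : E, ‖r‖ * ‖y‖ ≤ ‖D y - r • y‖)
    (p : ℂ[X]) (hp : ∀ r ∈ p.roots, r.re = 0) (y : E) :
    ‖p.eval 0‖ * ‖y‖ ≤ ‖aeval D p y‖ := by
  have key : ∀ s : Multiset ℂ, (∀ r ∈ s, r.re = 0) → ∀ y : E,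
      ‖(s.map (fun a => X - C a)).prod.eval 0‖ * ‖y‖ ≤
        ‖aeval D (s.map (fun a => X - C a)).prod y‖ := by
    intro s
    induction s using Multiset.induction_on with
    | empty => intro _ y; simp
    | cons a s ih =>
      intro hs y
      rw [Multiset.map_cons, Multiset.prod_cons, eval_mul, map_mul, norm_mul, mul_assoc]
      have h1 := ih (fun r hr => hs r (Multiset.mem_cons_of_mem hr)) y
      have h2 := hD a (hs a (Multiset.mem_cons_self a s))
        (aeval D (s.map (fun a => X - C a)).prod y)
      calc _ = ‖a‖ * (‖(s.map (fun a => X - C a)).prod.eval 0‖ * ‖y‖) := by simp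
        _ ≤ ‖a‖ * ‖aeval D (s.map (fun a => X - C a)).prod y‖ := by gcongr
        _ ≤ _ := h2
        _ = _ := by
          congr 1
          simp [Algebra.algebraMap_eq_smul_one]
  have hsplit := (IsAlgClosed.splits p).eq_prod_roots
  rw [hsplit, eval_mul, map_mul, norm_mul, eval_C, mul_assoc, aeval_C]
  have h : (algebraMap ℂ (E →L[ℂ] E) p.leadingCoeff *
      aeval D (p.roots.map (fun a => X - C a)).prod) y =
        p.leadingCoeff • aeval D (p.roots.map (fun a => X - C a)).prod y := by
    simp [Algebra.algebraMap_eq_smul_one]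
  rw [h, norm_smul]
  exact mul_le_mul_of_nonneg_left (key p.roots hp y) (norm_nonneg _)

theorem two_mul_norm_le_norm_exp_add_exp_neg [CompleteSpace E] (D : E →L[ℂ] E)
    (hD : ∀ r : ℂ, r.re = 0 → ∀ y : E, ‖r‖ * ‖y‖ ≤ ‖D y - r • y‖) (y : E) :
    2 * ‖y‖ ≤ ‖NormedSpace.exp D y + NormedSpace.exp (-D) y‖ := by
  -- The exponential limit needs `NormOneClass` on `E →L[ℂ] E`, hence `E` nontrivial.
  cases subsingleton_or_nontrivial E
  · simp [Subsingleton.elim y 0]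
  have hlim : Filter.Tendsto
      (fun n : ℕ => ((1 + (n : ℂ)⁻¹ • D) ^ n) y + ((1 + (n : ℂ)⁻¹ • (-D)) ^ n) y)
      Filter.atTop (nhds (NormedSpace.exp D y + NormedSpace.exp (-D) y)) :=
    (((ContinuousLinearMap.apply ℂ E y).continuous.tendsto _).comp
      (tendsto_one_add_smul_pow_exp D)).add
    (((ContinuousLinearMap.apply ℂ E y).continuous.tendsto _).comp
      (tendsto_one_add_smul_pow_exp (-D)))
  refine ge_of_tendsto hlim.norm ((Filter.eventually_ne_atTop 0).mono fun n hn => ?_)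
  let p : ℂ[X] := (1 + C (n : ℂ)⁻¹ * X) ^ n + (1 - C (n : ℂ)⁻¹ * X) ^ n
  have hp : ∀ r ∈ p.roots, r.re = 0 := by
    intro r hr
    have h0 : (1 + (n : ℂ)⁻¹ * r) ^ n + (1 - (n : ℂ)⁻¹ * r) ^ n = 0 := by
      simpa [p] using (mem_roots'.1 hr).2
    -- A zero satisfies `|1 + r/n| = |1 - r/n|`: it is equidistant from `n` and `-n`, hence
    -- imaginary.
    have h1 := congrArg norm (eq_neg_of_add_eq_zero_left h0)
    rw [norm_neg, norm_pow, norm_pow,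
      pow_left_inj₀ (norm_nonneg _) (norm_nonneg _) hn] at h1
    have h2 : ‖1 + (n : ℂ)⁻¹ * r‖ ^ 2 = ‖1 - (n : ℂ)⁻¹ * r‖ ^ 2 := by rw [h1]
    rw [← Complex.normSq_eq_norm_sq, ← Complex.normSq_eq_norm_sq, Complex.normSq_add,
      Complex.normSq_sub] at h2
    have h3 : ((n : ℂ)⁻¹ * r).re = (n : ℝ)⁻¹ * r.re := by
      rw [← Complex.ofReal_natCast, ← Complex.ofReal_inv, Complex.re_ofReal_mul]
    have h4 : ((n : ℂ)⁻¹ * r).re = 0 := by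
      simp only [one_mul, Complex.conj_re] at h2
      linarith
    rw [h3] at h4
    exact (mul_eq_zero.1 h4).resolve_left (by simpa using hn)
  have := norm_eval_zero_mul_le_norm_aeval D hD p hp y
  have h2 : p.eval 0 = 2 := by simp [p]; norm_num
  rw [h2] at this
  simpa [p, sub_eq_add_neg, Algebra.smul_def] using this

end

/-! ### Left and right multiplications on the completion, and their exponentials. -/

namespace NormedIdeal

variable {M : Type*} [CStarAlgebra M] (I : NormedIdeal M)

theorem norm_leftMul_apply_le (A : M) (X : I.Completion) : ‖I.leftMul A X‖ ≤ ‖A‖ * ‖X‖ := by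
  induction X using UniformSpace.Completion.induction_on with
  | hp => exact isClosed_le (by fun_prop) (by fun_prop)
  | ih Y =>
    rw [leftMul_coe, UniformSpace.Completion.norm_coe, UniformSpace.Completion.norm_coe]
    exact (I.coreLeftMul A).le_of_opNorm_le
      (LinearMap.mkContinuous_norm_le _ (norm_nonneg A) _) Y

theorem norm_rightMul_apply_le (B : M) (X : I.Completion) : ‖I.rightMul B X‖ ≤ ‖B‖ * ‖X‖ := by
  induction X using UniformSpace.Completion.induction_on with
  | hp => exact isClosed_le (by fun_prop) (by fun_prop)
  | ih Y =>
    rw [rightMul_coe, UniformSpace.Completion.norm_coe, UniformSpace.Completion.norm_coe]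
    exact (I.coreRightMul B).le_of_opNorm_le
      (LinearMap.mkContinuous_norm_le _ (norm_nonneg B) _) Y

theorem ext_coe {f g : I.Completion →L[ℂ] I.Completion}
    (h : ∀ Y : I.Core, f (Y : I.Completion) = g (Y : I.Completion)) : f = g := by
  ext X
  induction X using UniformSpace.Completion.induction_on with
  | hp => exact isClosed_eq f.continuous g.continuous
  | ih Y => exact h Y

theorem leftMul_one : I.leftMul 1 = 1 := by
  refine I.ext_coe fun Y => ?_
  rw [leftMul_coe]
  exact congrArg _ (Subtype.ext (one_mul Y.val))

theorem rightMul_one : I.rightMul 1 = 1 := by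
  refine I.ext_coe fun Y => ?_
  rw [rightMul_coe]
  exact congrArg _ (Subtype.ext (mul_one Y.val))

theorem leftMul_mul (A A' : M) : I.leftMul (A * A') = I.leftMul A * I.leftMul A' := by
  refine I.ext_coe fun Y => ?_
  rw [mul_apply_eq_comp, leftMul_coe, leftMul_coe, leftMul_coe]
  exact congrArg _ (Subtype.ext (mul_assoc A A' Y.val))

theorem rightMul_mul (B B' : M) : I.rightMul (B * B') = I.rightMul B' * I.rightMul B := by
  refine I.ext_coe fun Y => ?_
  rw [mul_apply_eq_comp, rightMul_coe, rightMul_coe, rightMul_coe]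
  exact congrArg _ (Subtype.ext (mul_assoc Y.val B B').symm)

theorem leftMul_add (A A' : M) : I.leftMul (A + A') = I.leftMul A + I.leftMul A' := by
  refine I.ext_coe fun Y => ?_
  rw [add_apply, leftMul_coe, leftMul_coe, leftMul_coe, ← UniformSpace.Completion.coe_add]
  exact congrArg _ (Subtype.ext (add_mul A A' Y.val))

theorem rightMul_add (B B' : M) : I.rightMul (B + B') = I.rightMul B + I.rightMul B' := by
  refine I.ext_coe fun Y => ?_
  rw [add_apply, rightMul_coe, rightMul_coe, rightMul_coe, ← UniformSpace.Completion.coe_add]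
  exact congrArg _ (Subtype.ext (mul_add Y.val B B'))

theorem leftMul_smul (c : ℂ) (A : M) : I.leftMul (c • A) = c • I.leftMul A := by
  refine I.ext_coe fun Y => ?_
  rw [smul_apply, leftMul_coe, leftMul_coe, ← UniformSpace.Completion.coe_smul]
  exact congrArg _ (Subtype.ext (smul_mul_assoc c A Y.val))

theorem rightMul_smul (c : ℂ) (B : M) : I.rightMul (c • B) = c • I.rightMul B := by
  refine I.ext_coe fun Y => ?_
  rw [smul_apply, rightMul_coe, rightMul_coe, ← UniformSpace.Completion.coe_smul]
  exact congrArg _ (Subtype.ext (mul_smul_comm c Y.val B))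

theorem commute_leftMul_rightMul (A B : M) : Commute (I.leftMul A) (I.rightMul B) := by
  refine I.ext_coe fun Y => ?_
  rw [mul_apply_eq_comp, mul_apply_eq_comp, leftMul_coe, rightMul_coe,
    leftMul_coe, rightMul_coe]
  exact congrArg _ (Subtype.ext (mul_assoc A Y.val B).symm)

/-- Left multiplication as an algebra homomorphism into the operators on the completion. -/
noncomputable def leftMulHom : M →ₐ[ℂ] (I.Completion →L[ℂ] I.Completion) :=
  AlgHom.ofLinearMap
    { toFun := I.leftMul, map_add' := I.leftMul_add, map_smul' := I.leftMul_smul }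
    I.leftMul_one I.leftMul_mul

/-- Right multiplication as an algebra homomorphism from the opposite algebra. -/
noncomputable def rightMulHom : Mᵐᵒᵖ →ₐ[ℂ] (I.Completion →L[ℂ] I.Completion) :=
  AlgHom.ofLinearMap
    { toFun := fun B => I.rightMul B.unop
      map_add' := fun B B' => I.rightMul_add B.unop B'.unop
      map_smul' := fun c B => I.rightMul_smul c B.unop }
    I.rightMul_one (fun B B' => I.rightMul_mul B'.unop B.unop)

theorem leftMul_exp (A : M) : I.leftMul (NormedSpace.exp A) = NormedSpace.exp (I.leftMul A) := by
  let _ : NormedAlgebra ℚ M := NormedAlgebra.restrictScalars ℚ ℂ M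
  let _ : NormedAlgebra ℚ (I.Completion →L[ℂ] I.Completion) :=
    NormedAlgebra.restrictScalars ℚ ℂ _
  refine NormedSpace.map_exp I.leftMulHom ?_ A
  exact AddMonoidHomClass.continuous_of_bound I.leftMulHom 1 fun A => by
    rw [one_mul]
    exact ContinuousLinearMap.opNorm_le_bound _ (norm_nonneg A) (I.norm_leftMul_apply_le A)

theorem rightMul_exp (B : M) :
    I.rightMul (NormedSpace.exp B) = NormedSpace.exp (I.rightMul B) := by
  let _ : NormedAlgebra ℚ Mᵐᵒᵖ := NormedAlgebra.restrictScalars ℚ ℂ Mᵐᵒᵖ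
  let _ : NormedAlgebra ℚ (I.Completion →L[ℂ] I.Completion) :=
    NormedAlgebra.restrictScalars ℚ ℂ _
  have h : Continuous I.rightMulHom :=
    AddMonoidHomClass.continuous_of_bound I.rightMulHom 1 fun B => by
      rw [one_mul]
      exact ContinuousLinearMap.opNorm_le_bound _ (norm_nonneg B)
        (I.norm_rightMul_apply_le B.unop)
  have := NormedSpace.map_exp I.rightMulHom h (MulOpposite.op B)
  rwa [NormedSpace.exp_op] at this

/-- By the C⋆-identity the squared norm is that of `1 + ε²H²`; the terms linear in `ε` cancel
because `H` is self-adjoint. -/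
theorem norm_one_add_smul_I_sq_le {H : M} (hH : IsSelfAdjoint H) (ε : ℝ) :
    ‖1 + (ε * Complex.I : ℂ) • H‖ ^ 2 ≤ 1 + ε ^ 2 * ‖H‖ ^ 2 := by
  have h1 : ‖(1 : M)‖ ≤ 1 := by
    cases subsingleton_or_nontrivial M
    · simp [Subsingleton.elim (1 : M) 0]
    · simp
  have e : star (1 + (ε * Complex.I : ℂ) • H) * (1 + (ε * Complex.I : ℂ) • H) =
      1 + ((ε ^ 2 : ℝ) : ℂ) • (H * H) := by
    have : (-(ε * Complex.I) * (ε * Complex.I) : ℂ) = ((ε ^ 2 : ℝ) : ℂ) := by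
      push_cast
      linear_combination (-(ε : ℂ) ^ 2) * Complex.I_mul_I
    rw [star_add, star_one, star_smul, hH.star_eq, ← this]
    simp only [star_mul', RCLike.star_def, Complex.conj_ofReal, Complex.conj_I, mul_neg,
      add_mul, mul_add, one_mul, mul_one, smul_mul_smul_comm]
    module
  rw [sq ‖_‖, ← CStarRing.norm_star_mul_self, e]
  refine (norm_add_le _ _).trans ?_
  rw [norm_smul, Complex.norm_real, Real.norm_of_nonneg (sq_nonneg ε), sq ‖H‖]
  gcongr
  exact norm_mul_le H H

/-- To first order in `ε` the operator is `Y ↦ (1 + iεH) Y (1 - iεK)`; the error is exactly `ε²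
HYK`. -/
theorem norm_add_smul_I_leftMul_sub_rightMul_le {H K : M} (hH : IsSelfAdjoint H)
    (hK : IsSelfAdjoint K) (ε : ℝ) (Y : I.Completion) :
    ‖Y + (ε * Complex.I : ℂ) • (I.leftMul H - I.rightMul K) Y‖ ≤
      (1 + (‖H‖ + ‖K‖) ^ 2 / 2 * ε ^ 2) * ‖Y‖ := by
  have e : Y + (ε * Complex.I : ℂ) • (I.leftMul H - I.rightMul K) Y =
      I.leftMul (1 + (ε * Complex.I : ℂ) • H)
        (I.rightMul (1 + ((-ε : ℝ) * Complex.I : ℂ) • K) Y)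
        - ((ε ^ 2 : ℝ) : ℂ) • I.leftMul H (I.rightMul K Y) := by
    have : ((ε ^ 2 : ℝ) : ℂ) = -(ε * Complex.I) * (ε * Complex.I) := by
      push_cast
      linear_combination ((ε : ℂ) ^ 2) * Complex.I_mul_I
    rw [this]
    simp only [leftMul_add, rightMul_add, leftMul_one, rightMul_one, leftMul_smul,
      rightMul_smul, add_apply, sub_apply, smul_apply, map_add, map_smul,
      one_apply_eq_self, Complex.ofReal_neg]
    module
  rw [e]
  have h1 := norm_one_add_smul_I_sq_le hH ε
  have h2 := norm_one_add_smul_I_sq_le hK (-ε)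
  set U := 1 + (ε * Complex.I : ℂ) • H
  set V := 1 + ((-ε : ℝ) * Complex.I : ℂ) • K
  -- The scalar inequality `‖U‖‖V‖ ≤ (‖U‖² + ‖V‖²)/2` avoids square roots.
  have h3 : ‖U‖ * ‖V‖ ≤ 1 + ε ^ 2 * ((‖H‖ ^ 2 + ‖K‖ ^ 2) / 2) := by
    nlinarith [sq_nonneg (‖U‖ - ‖V‖)]
  have hb : ∀ A B : M, ‖I.leftMul A (I.rightMul B Y)‖ ≤ ‖A‖ * ‖B‖ * ‖Y‖ := fun A B =>
    (I.norm_leftMul_apply_le A _).trans (by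
      rw [mul_assoc]; gcongr; exact I.norm_rightMul_apply_le B Y)
  calc _ ≤ ‖U‖ * ‖V‖ * ‖Y‖ + ε ^ 2 * (‖H‖ * ‖K‖ * ‖Y‖) := by
        refine (norm_sub_le _ _).trans ?_
        rw [norm_smul, Complex.norm_real, Real.norm_of_nonneg (sq_nonneg ε)]
        gcongr
        · exact hb U V
        · exact hb H K
    _ ≤ (1 + ε ^ 2 * ((‖H‖ ^ 2 + ‖K‖ ^ 2) / 2)) * ‖Y‖ + ε ^ 2 * (‖H‖ * ‖K‖ * ‖Y‖) := by
        gcongr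
    _ = _ := by ring

theorem exp_leftMul_sub_rightMul_apply (H K : M) (Y : I.Completion) :
    NormedSpace.exp (I.leftMul H - I.rightMul K) Y =
      I.leftMul (NormedSpace.exp H) (I.rightMul (NormedSpace.exp (-K)) Y) := by
  let _ : NormedAlgebra ℚ (I.Completion →L[ℂ] I.Completion) :=
    NormedAlgebra.restrictScalars ℚ ℂ _
  have hneg : I.rightMul (-K) = -I.rightMul K := map_neg I.rightMulHom (MulOpposite.op K)
  rw [sub_eq_add_neg, ← hneg, NormedSpace.exp_add_of_commute (I.commute_leftMul_rightMul H (-K)),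
    leftMul_exp, rightMul_exp, mul_apply_eq_comp]

theorem two_mul_norm_le_of_exp {H K : M} (hH : IsSelfAdjoint H) (hK : IsSelfAdjoint K)
    (Y : I.Completion) :
    2 * ‖Y‖ ≤ ‖I.leftMul (NormedSpace.exp H) (I.rightMul (NormedSpace.exp (-K)) Y) +
      I.leftMul (NormedSpace.exp (-H)) (I.rightMul (NormedSpace.exp K) Y)‖ := by
  have h := two_mul_norm_le_norm_exp_add_exp_neg (I.leftMul H - I.rightMul K)
    (norm_smul_le_norm_sub_smul_of_quadratic_bound _ _
      (I.norm_add_smul_I_leftMul_sub_rightMul_le hH hK)) Y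
  have hnegl : I.leftMul (-H) = -I.leftMul H := map_neg I.leftMulHom H
  have hnegr : I.rightMul (-K) = -I.rightMul K := map_neg I.rightMulHom (MulOpposite.op K)
  rwa [show -(I.leftMul H - I.rightMul K) = I.leftMul (-H) - I.rightMul (-K) by
      rw [hnegl, hnegr]; abel, exp_leftMul_sub_rightMul_apply,
    exp_leftMul_sub_rightMul_apply, neg_neg] at h

/-- Apply the hyperbolic cosine bound to `e^H X e^K`: the outer exponentials cancel one factor on
one side and double the other. -/
theorem two_mul_norm_exp_mul_exp_le {H K : M} (hH : IsSelfAdjoint H) (hK : IsSelfAdjoint K)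
    (X : I.Completion) :
    2 * ‖I.leftMul (NormedSpace.exp H) (I.rightMul (NormedSpace.exp K) X)‖ ≤
      ‖I.leftMul (NormedSpace.exp H * NormedSpace.exp H) X +
        I.rightMul (NormedSpace.exp K * NormedSpace.exp K) X‖ := by
  let _ : NormedAlgebra ℚ M := NormedAlgebra.restrictScalars ℚ ℂ M
  have h := I.two_mul_norm_le_of_exp hH hK
    (I.leftMul (NormedSpace.exp H) (I.rightMul (NormedSpace.exp K) X))
  have hK' : NormedSpace.exp K * NormedSpace.exp (-K) = 1 := by
    rw [← NormedSpace.exp_add_of_commute (Commute.neg_right (Commute.refl K)), add_neg_cancel,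
      NormedSpace.exp_zero]
  have hH' : NormedSpace.exp (-H) * NormedSpace.exp H = 1 := by
    rw [← NormedSpace.exp_add_of_commute (Commute.neg_left (Commute.refl H)), neg_add_cancel,
      NormedSpace.exp_zero]
  have hl : ∀ (A A' : M) (Z : I.Completion),
      I.leftMul A (I.leftMul A' Z) = I.leftMul (A * A') Z := fun A A' Z => by
    rw [leftMul_mul, mul_apply_eq_comp]
  have hr : ∀ (A A' : M) (Z : I.Completion),
      I.rightMul A' (I.rightMul A Z) = I.rightMul (A * A') Z := fun A A' Z => by
    rw [rightMul_mul, mul_apply_eq_comp]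
  have hlr : ∀ (A B : M) (Z : I.Completion),
      I.rightMul B (I.leftMul A Z) = I.leftMul A (I.rightMul B Z) := fun A B Z =>
    (DFunLike.congr_fun (I.commute_leftMul_rightMul A B).eq Z).symm
  simpa only [hlr, hl, hr, hK', hH', leftMul_one, rightMul_one, one_apply_eq_self] using h

end NormedIdeal

/-! ### Regularised polar decomposition and conclusion. -/

/-- Adding `ε` makes `AA*` strictly positive, so `H` can be half its logarithm. Then `V = A* e^{-H}`
is a contraction, since `V*V = e^{-H} AA* e^{-H} ≤ e^{-H} e^{2H} e^{-H} = 1`. -/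
theorem CStarAlgebra.exists_eq_mul_exp {M : Type*} [CStarAlgebra M] (A : M) {ε : ℝ}
    (hε : 0 < ε) : ∃ H V : M, IsSelfAdjoint H ∧ ‖V‖ ≤ 1 ∧ star A = V * NormedSpace.exp H ∧
      NormedSpace.exp H * NormedSpace.exp H = A * star A + algebraMap ℝ M ε := by
  let _ := CStarAlgebra.spectralOrder M
  have _ := CStarAlgebra.spectralOrderedRing M
  let _ : NormedAlgebra ℚ M := NormedAlgebra.restrictScalars ℚ ℂ M
  have hpos : IsStrictlyPositive (A * star A + algebraMap ℝ M ε) :=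
    (isStrictlyPositive_algebraMap hε).nonneg_add (mul_star_self_nonneg A)
  set G := CFC.log (A * star A + algebraMap ℝ M ε)
  have hG : IsSelfAdjoint G := IsSelfAdjoint.log
  set H := (2⁻¹ : ℝ) • G with hHdef
  have hH : IsSelfAdjoint H := (IsSelfAdjoint.all _).smul hG
  have hHH : NormedSpace.exp H * NormedSpace.exp H = A * star A + algebraMap ℝ M ε := by
    rw [← NormedSpace.exp_add_of_commute (Commute.refl H), hHdef, ← add_smul,
      show (2⁻¹ + 2⁻¹ : ℝ) = 1 by norm_num, one_smul]
    exact CFC.exp_log _ hpos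
  have h1 : NormedSpace.exp (-H) * NormedSpace.exp H = 1 := by
    rw [← NormedSpace.exp_add_of_commute (Commute.neg_left (Commute.refl H)), neg_add_cancel,
      NormedSpace.exp_zero]
  have h2 : NormedSpace.exp H * NormedSpace.exp (-H) = 1 := by
    rw [← NormedSpace.exp_add_of_commute (Commute.neg_right (Commute.refl H)), add_neg_cancel,
      NormedSpace.exp_zero]
  have hsa : IsSelfAdjoint (NormedSpace.exp (-H)) := hH.neg.exp
  refine ⟨H, star A * NormedSpace.exp (-H), hH, ?_, by rw [mul_assoc, h1, mul_one], hHH⟩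
  have hle : star (star A * NormedSpace.exp (-H)) * (star A * NormedSpace.exp (-H)) ≤ 1 := by
    have h3 := hsa.conjugate_le_conjugate (a := A * star A)
      (b := NormedSpace.exp H * NormedSpace.exp H) (by
        rw [hHH]
        exact le_add_of_nonneg_right (isStrictlyPositive_algebraMap hε).nonneg)
    calc _ = NormedSpace.exp (-H) * (A * star A) * NormedSpace.exp (-H) := by
          rw [star_mul, star_star, hsa.star_eq]; simp only [mul_assoc]
      _ ≤ _ := h3
      _ = (NormedSpace.exp (-H) * NormedSpace.exp H) *
          (NormedSpace.exp H * NormedSpace.exp (-H)) := by simp only [mul_assoc]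
      _ = 1 := by rw [h1, h2, mul_one]
  have h4 := (CStarAlgebra.norm_le_one_iff_of_nonneg _ (star_mul_self_nonneg _)).2 hle
  rw [CStarRing.norm_star_mul_self] at h4
  nlinarith [norm_nonneg (star A * NormedSpace.exp (-H))]

theorem mainTheorem6 {M : Type*} [CStarAlgebra M] (I : NormedIdeal M) (A B : M)
    (X : I.Completion) :
    ‖I.leftMul (A * star A) X + I.rightMul (B * star B) X‖ ≥
      2 * ‖I.leftMul (star A) (I.rightMul B X)‖ := by
  -- The regularisations of `AA*` and `BB*` each contribute `εX`, whence `2ε`.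
  have key : ∀ ε : ℝ, 0 < ε → 2 * ‖I.leftMul (star A) (I.rightMul B X)‖ ≤
      ‖I.leftMul (A * star A) X + I.rightMul (B * star B) X + ((2 * ε : ℝ) : ℂ) • X‖ := by
    intro ε hε
    obtain ⟨H, V, hH, hV, hA, hHH⟩ := CStarAlgebra.exists_eq_mul_exp A hε
    obtain ⟨K, W, hK, hW, hB, hKK⟩ := CStarAlgebra.exists_eq_mul_exp B hε
    have hB' : B = NormedSpace.exp K * star W := by
      rw [← star_star B, hB, star_mul, hK.exp.star_eq]
    have h := I.two_mul_norm_exp_mul_exp_le hH hK X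
    have hle : ‖I.leftMul (star A) (I.rightMul B X)‖ ≤
        ‖I.leftMul (NormedSpace.exp H) (I.rightMul (NormedSpace.exp K) X)‖ := by
      -- This is `A* X B = V (e^H X e^K) W*` with `V` and `W` contractions.
      have e : I.leftMul (star A) (I.rightMul B X) = I.leftMul V (I.rightMul (star W)
          (I.leftMul (NormedSpace.exp H) (I.rightMul (NormedSpace.exp K) X))) := by
        have hc := DFunLike.congr_fun
          (I.commute_leftMul_rightMul (NormedSpace.exp H) (star W)).eq
          (I.rightMul (NormedSpace.exp K) X)
        simp only [mul_apply_eq_comp] at hc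
        rw [hA, ← hc]
        conv_lhs => rw [hB']
        rw [I.leftMul_mul, I.rightMul_mul, mul_apply_eq_comp,
          mul_apply_eq_comp]
      rw [e]
      refine (I.norm_leftMul_apply_le _ _).trans
        ((mul_le_of_le_one_left (norm_nonneg _) hV).trans ?_)
      refine (I.norm_rightMul_apply_le _ _).trans
        (mul_le_of_le_one_left (norm_nonneg _) ?_)
      rwa [norm_star]
    have halg : algebraMap ℝ M ε = (ε : ℂ) • (1 : M) := by
      rw [Algebra.algebraMap_eq_smul_one, Complex.coe_smul]
    refine (mul_le_mul_of_nonneg_left hle zero_le_two).trans (h.trans (le_of_eq ?_))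
    rw [hHH, hKK, halg, I.leftMul_add, I.rightMul_add, I.leftMul_smul, I.rightMul_smul,
      I.leftMul_one, I.rightMul_one]
    simp only [add_apply, smul_apply, one_apply_eq_self]
    congr 1
    push_cast
    module
  have hc : Continuous fun ε : ℝ =>
      ‖I.leftMul (A * star A) X + I.rightMul (B * star B) X + ((2 * ε : ℝ) : ℂ) • X‖ := by
    fun_prop
  have hlim := (hc.tendsto 0).mono_left (nhdsWithin_le_nhds (s := Set.Ioi 0))
  have := ge_of_tendsto hlim (Filter.eventually_of_mem self_mem_nhdsWithin key)
  simpa using this
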